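/- All C*-algebras are unital and all $*$-homomorphisms are unital; $\otimes$ denotes the minimal tensor product of C*-algebras. Quantum spaces are compact: a quantum space $\mathbb{E}$ is given by a unital C*-algebra $\mathrm{C}(\mathbb{E})$. A quantum family of maps $\mathbb{X}\to\mathbb{Y}$ parametrized by $\mathbb{D}$ is a $*$-homomorphism $\Psi\colon\mathrm{C}(\mathbb{Y})\to\mathrm{C}(\mathbb{X})\otimes\mathrm{C}(\mathbb{D})$. The C*-algebra $\mathrm{C}(\mathbb{Y})$ is finitely generated if it has a finite subset for which the unital $*$-subalgebra it generates is dense. Theorem. Let $\mathbb{X}$ and $\mathbb{Y}$ be quantum spaces such that $\mathrm{C}(\mathbb{X})$ is finite-dimensional and $\mathrm{C}(\mathbb{Y})$ is unital and finitely generated. Then the quantum space of all maps $\mathbb{X}\to\mathbb{Y}$ exists and is compact. That is, there are a unital C*-algebra $\mathrm{C}(\mathbb{E})$ and a unital $*$-homomorphism $\Phi\colon\mathrm{C}(\mathbb{Y})\to\mathrm{C}(\mathbb{X})\otimes\mathrm{C}(\mathbb{E})$ such that for every unital C*-algebra $\mathrm{C}(\mathbb{D})$ and every unital $*$-homomorphism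 $\Psi\colon\mathrm{C}(\mathbb{Y})\to\mathrm{C}(\mathbb{X})\otimes\mathrm{C}(\mathbb{D})$ there is a unique unital $*$-homomorphism $\Lambda\colon\mathrm{C}(\mathbb{E})\to\mathrm{C}(\mathbb{D})$ with $$(\mathrm{id}\otimes\Lambda)\circ\Phi=\Psi .$$ -/

import Mathlib

open scoped TensorProduct ENNReal

universe u v w

noncomputable section

/-- The algebra of bounded families of elements of a family of nonzero unital C*-algebras, with
the supremum norm, is a unital C*-algebra. -/
instance lpInftyCStarAlgebra {I : Type*} {A : I → Type*} [∀ i, Nontrivial (A i)]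
    [∀ i, CStarAlgebra (A i)] : CStarAlgebra (lp A ∞) where

/-- A nonzero (unital) representation of a unital C*-algebra on a complex Hilbert space. -/
structure HilbertRep (A : Type u) [CStarAlgebra A] : Type (u + 1) where
  space : Type u
  [instNormed : NormedAddCommGroup space]
  [instInner : InnerProductSpace ℂ space]
  [instComplete : CompleteSpace space]
  [instNontrivial : Nontrivial space]
  hom : A →⋆ₐ[ℂ] (space →L[ℂ] space)

attribute [instance] HilbertRep.instNormed HilbertRep.instInner HilbertRep.instComplete
  HilbertRep.instNontrivial

/-- The representation of `B` obtained from one of `C` by composing with `f : B → C`. -/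
def HilbertRep.comap {B C : Type v} [CStarAlgebra B] [CStarAlgebra C] (σ : HilbertRep C)
    (f : B →⋆ₐ[ℂ] C) : HilbertRep B where
  space := σ.space
  hom := σ.hom.comp f

section HilbertTensor

variable (H : Type u) [NormedAddCommGroup H] [InnerProductSpace ℂ H]
  (K : Type v) [NormedAddCommGroup K] [InnerProductSpace ℂ K]

/-- The Hilbert space tensor product: the completion of the algebraic tensor product. -/
def HilbertTensor : Type (max u v) := UniformSpace.Completion (H ⊗[ℂ] K)

instance : NormedAddCommGroup (HilbertTensor H K) :=
  inferInstanceAs (NormedAddCommGroup (UniformSpace.Completion (H ⊗[ℂ] K)))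

instance : InnerProductSpace ℂ (HilbertTensor H K) :=
  inferInstanceAs (InnerProductSpace ℂ (UniformSpace.Completion (H ⊗[ℂ] K)))

instance : CompleteSpace (HilbertTensor H K) :=
  inferInstanceAs (CompleteSpace (UniformSpace.Completion (H ⊗[ℂ] K)))

/-- The canonical isometric embedding of the algebraic tensor product. -/
def HilbertTensor.of : H ⊗[ℂ] K →ₗᵢ[ℂ] HilbertTensor H K :=
  UniformSpace.Completion.toComplₗᵢ

theorem HilbertTensor.denseRange_of : DenseRange (HilbertTensor.of H K) :=
  UniformSpace.Completion.denseRange_coe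

instance [Nontrivial H] [Nontrivial K] : Nontrivial (HilbertTensor H K) := by
  obtain ⟨x, hx⟩ := exists_ne (0 : H)
  obtain ⟨y, hy⟩ := exists_ne (0 : K)
  refine ⟨⟨HilbertTensor.of H K (x ⊗ₜ[ℂ] y), 0, fun h => ?_⟩⟩
  have h2 : ‖HilbertTensor.of H K (x ⊗ₜ[ℂ] y)‖ = 0 := by rw [h, norm_zero]
  rw [LinearIsometry.norm_map, TensorProduct.norm_tmul] at h2
  simp [hx, hy] at h2

variable {H K}

/-- The bounded operator `S ⊗ T` on the Hilbert space tensor product. -/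
def opTensor (S : H →L[ℂ] H) (T : K →L[ℂ] K) : HilbertTensor H K →L[ℂ] HilbertTensor H K :=
  (TensorProduct.mapL S T).completion

theorem opTensor_of (S : H →L[ℂ] H) (T : K →L[ℂ] K) (x : H ⊗[ℂ] K) :
    opTensor S T (HilbertTensor.of H K x) =
      HilbertTensor.of H K (TensorProduct.map S.toLinearMap T.toLinearMap x) := by
  rw [← TensorProduct.mapL_apply]
  exact ContinuousLinearMap.completion_apply_coe (TensorProduct.mapL S T) x

theorem HilbertTensor.clm_ext {f g : HilbertTensor H K →L[ℂ] HilbertTensor H K}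
    (h : ∀ (x : H) (y : K), f (HilbertTensor.of H K (x ⊗ₜ[ℂ] y)) =
      g (HilbertTensor.of H K (x ⊗ₜ[ℂ] y))) : f = g := by
  have h2 : ∀ x, f (HilbertTensor.of H K x) = g (HilbertTensor.of H K x) := fun x => by
    induction x using TensorProduct.induction_on with
    | zero => simp
    | add x y hx hy => rw [map_add, map_add, map_add, hx, hy]
    | tmul x y => exact h x y
  refine ContinuousLinearMap.coeFn_injective ?_
  exact (HilbertTensor.denseRange_of H K).equalizer f.continuous g.continuous (funext h2)

theorem opTensor_tmul (S : H →L[ℂ] H) (T : K →L[ℂ] K) (x : H) (y : K) :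
    opTensor S T (HilbertTensor.of H K (x ⊗ₜ[ℂ] y)) =
      HilbertTensor.of H K (S x ⊗ₜ[ℂ] T y) := by
  rw [opTensor_of]; rfl

theorem norm_opTensor_le (S : H →L[ℂ] H) (T : K →L[ℂ] K) : ‖opTensor S T‖ ≤ ‖S‖ * ‖T‖ := by
  refine ContinuousLinearMap.opNorm_le_bound _ (by positivity) fun x => ?_
  refine (HilbertTensor.denseRange_of H K).induction_on
    (p := fun x => ‖opTensor S T x‖ ≤ ‖S‖ * ‖T‖ * ‖x‖) x
    (isClosed_le (by fun_prop) (by fun_prop)) fun x => ?_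
  rw [opTensor_of, LinearIsometry.norm_map, LinearIsometry.norm_map]
  rw [← TensorProduct.mapL_apply]
  exact ((TensorProduct.mapL S T).le_opNorm x).trans
    (mul_le_mul_of_nonneg_right (TensorProduct.norm_mapL_le S T) (norm_nonneg _))

theorem opTensor_mul (S S' : H →L[ℂ] H) (T T' : K →L[ℂ] K) :
    opTensor (S * S') (T * T') = opTensor S T * opTensor S' T' :=
  HilbertTensor.clm_ext fun x y => by
    change _ = opTensor S T (opTensor S' T' _)
    rw [opTensor_tmul, opTensor_tmul, opTensor_tmul]
    rfl

theorem opTensor_one : opTensor (1 : H →L[ℂ] H) (1 : K →L[ℂ] K) = 1 :=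
  HilbertTensor.clm_ext fun x y => by rw [opTensor_tmul]; rfl

theorem opTensor_add_left (S S' : H →L[ℂ] H) (T : K →L[ℂ] K) :
    opTensor (S + S') T = opTensor S T + opTensor S' T :=
  HilbertTensor.clm_ext fun x y => by
    change _ = opTensor S T _ + opTensor S' T _
    rw [opTensor_tmul, opTensor_tmul, opTensor_tmul, ← map_add, ← TensorProduct.add_tmul]
    rfl

theorem opTensor_add_right (S : H →L[ℂ] H) (T T' : K →L[ℂ] K) :
    opTensor S (T + T') = opTensor S T + opTensor S T' :=
  HilbertTensor.clm_ext fun x y => by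
    change _ = opTensor S T _ + opTensor S T' _
    rw [opTensor_tmul, opTensor_tmul, opTensor_tmul, ← map_add, ← TensorProduct.tmul_add]
    rfl

theorem opTensor_smul_left (c : ℂ) (S : H →L[ℂ] H) (T : K →L[ℂ] K) :
    opTensor (c • S) T = c • opTensor S T :=
  HilbertTensor.clm_ext fun x y => by
    change _ = c • opTensor S T _
    rw [opTensor_tmul, opTensor_tmul, ← map_smul, TensorProduct.smul_tmul']
    rfl

theorem opTensor_smul_right (c : ℂ) (S : H →L[ℂ] H) (T : K →L[ℂ] K) :
    opTensor S (c • T) = c • opTensor S T :=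
  HilbertTensor.clm_ext fun x y => by
    change _ = c • opTensor S T _
    rw [opTensor_tmul, opTensor_tmul, ← map_smul, ← TensorProduct.tmul_smul]
    rfl

theorem star_opTensor [CompleteSpace H] [CompleteSpace K] (S : H →L[ℂ] H) (T : K →L[ℂ] K) :
    star (opTensor S T) = opTensor (star S) (star T) := by
  symm
  rw [ContinuousLinearMap.star_eq_adjoint (opTensor S T)]
  refine (ContinuousLinearMap.eq_adjoint_iff _ _).mpr fun x y => ?_
  refine (HilbertTensor.denseRange_of H K).induction_on₂
    (p := fun x y => inner ℂ (opTensor (star S) (star T) x) y = inner ℂ x (opTensor S T y))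
    (isClosed_eq (by fun_prop) (by fun_prop)) (fun x y => ?_) x y
  rw [opTensor_of, opTensor_of, LinearIsometry.inner_map_map, LinearIsometry.inner_map_map]
  induction x using TensorProduct.induction_on with
  | zero => simp
  | add x x' hx hx' => simp only [map_add, inner_add_left, hx, hx']
  | tmul x x' =>
    induction y using TensorProduct.induction_on with
    | zero => simp
    | add y y' hy hy' => simp only [map_add, inner_add_right, hy, hy']
    | tmul y y' =>
      simp [ContinuousLinearMap.star_eq_adjoint, ContinuousLinearMap.adjoint_inner_left]

end HilbertTensor

section MinTensor

variable {A : Type u} [CStarAlgebra A] {B : Type v} [CStarAlgebra B]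

/-- The tensor product `π ⊗ ρ` of two representations, a unital *-homomorphism from the algebraic
tensor product `A ⊗ B` to the bounded operators on the Hilbert space tensor product;
it sends `a ⊗ b` to `π(a) ⊗ ρ(b)`. -/
def repTensor (π : HilbertRep A) (ρ : HilbertRep B) :
    A ⊗[ℂ] B →⋆ₐ[ℂ]
      (HilbertTensor π.space ρ.space →L[ℂ] HilbertTensor π.space ρ.space) :=
  let φ : A ⊗[ℂ] B →ₗ[ℂ]
      (HilbertTensor π.space ρ.space →L[ℂ] HilbertTensor π.space ρ.space) :=
    TensorProduct.lift (LinearMap.mk₂ ℂ (fun a b => opTensor (π.hom a) (ρ.hom b))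
      (fun a a' b => by simp only [map_add, opTensor_add_left])
      (fun c a b => by simp only [map_smul, opTensor_smul_left])
      (fun a b b' => by simp only [map_add, opTensor_add_right])
      (fun c a b => by simp only [map_smul, opTensor_smul_right]))
  have hφ : ∀ a b, φ (a ⊗ₜ[ℂ] b) = opTensor (π.hom a) (ρ.hom b) := fun _ _ => rfl
  { Algebra.TensorProduct.algHomOfLinearMapTensorProduct φ
      (fun a a' b b' => by simp only [hφ, map_mul, opTensor_mul])
      (by simp only [hφ, map_one, opTensor_one]) with
    map_star' := fun x => by
      change φ (star x) = star (φ x)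
      induction x using TensorProduct.induction_on with
      | zero => simp
      | add x y hx hy => simp only [star_add, map_add, hx, hy]
      | tmul a b => simp only [TensorProduct.star_tmul, hφ, map_star, star_opTensor] }

@[simp]
theorem repTensor_tmul (π : HilbertRep A) (ρ : HilbertRep B) (a : A) (b : B) :
    repTensor π ρ (a ⊗ₜ[ℂ] b) = opTensor (π.hom a) (ρ.hom b) := rfl

theorem exists_norm_repTensor_le (x : A ⊗[ℂ] B) :
    ∃ C : ℝ, ∀ (π : HilbertRep A) (ρ : HilbertRep B), ‖repTensor π ρ x‖ ≤ C := by
  induction x using TensorProduct.induction_on with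
  | zero => exact ⟨0, fun π ρ => by simp⟩
  | add x y hx hy =>
    obtain ⟨C, hC⟩ := hx
    obtain ⟨C', hC'⟩ := hy
    exact ⟨C + C', fun π ρ => by
      rw [map_add]; exact (norm_add_le _ _).trans (add_le_add (hC π ρ) (hC' π ρ))⟩
  | tmul a b =>
    refine ⟨‖a‖ * ‖b‖, fun π ρ => ?_⟩
    rw [repTensor_tmul]
    exact (norm_opTensor_le _ _).trans (mul_le_mul
      (NonUnitalStarAlgHom.norm_apply_le π.hom a) (NonUnitalStarAlgHom.norm_apply_le ρ.hom b)
      (norm_nonneg _) (norm_nonneg _))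

variable (A B)

/-- Bounded families of operators, one on each `H_π ⊗ H_ρ`. -/
abbrev BoundedFamilies : Type (max (u + 1) (v + 1)) :=
  lp (fun p : HilbertRep A × HilbertRep B =>
    HilbertTensor p.1.space p.2.space →L[ℂ] HilbertTensor p.1.space p.2.space) ∞

/-- The family `(π ⊗ ρ)(x)`, for all representations `π` of `A` and `ρ` of `B`. The norm of this
family is the minimal (spatial) C*-norm `sup ‖(π ⊗ ρ)(x)‖` of `x`. -/
def allRepTensor : A ⊗[ℂ] B →⋆ₐ[ℂ] BoundedFamilies A B where
  toFun x := ⟨fun p => repTensor p.1 p.2 x, memℓp_infty (by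
    obtain ⟨C, hC⟩ := exists_norm_repTensor_le x
    exact ⟨C, by rintro _ ⟨p, rfl⟩; exact hC p.1 p.2⟩)⟩
  map_one' := by ext1; funext p; exact map_one (repTensor p.1 p.2)
  map_mul' x y := by ext1; funext p; exact map_mul (repTensor p.1 p.2) x y
  map_zero' := by ext1; funext p; exact map_zero (repTensor p.1 p.2)
  map_add' x y := by ext1; funext p; exact map_add (repTensor p.1 p.2) x y
  commutes' c := by
    ext1; funext p; exact AlgHomClass.commutes (repTensor p.1 p.2) c
  map_star' x := by ext1; funext p; exact map_star (repTensor p.1 p.2) x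

/-- The minimal tensor product of the unital C*-algebras `A` and `B`, as a C*-algebra of bounded
families: the closure of the image of the algebraic tensor product. -/
def minTensorSubalgebra : StarSubalgebra ℂ (BoundedFamilies A B) :=
  (allRepTensor A B).range.topologicalClosure

/-- The minimal tensor product of the unital C*-algebras `A` and `B`: the completion of the
algebraic tensor product in the minimal C*-norm. -/
def MinTensor : Type (max (u + 1) (v + 1)) := minTensorSubalgebra A B

instance : CStarAlgebra (MinTensor A B) :=
  StarSubalgebra.cstarAlgebra (minTensorSubalgebra A B)
    (h_closed := StarSubalgebra.isClosed_topologicalClosure _)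

/-- The inclusion of the minimal tensor product in the algebra of bounded families. -/
def MinTensor.incl : MinTensor A B →⋆ₐ[ℂ] BoundedFamilies A B :=
  (minTensorSubalgebra A B).subtype

/-- The canonical map from the algebraic to the minimal tensor product. -/
def MinTensor.of : A ⊗[ℂ] B →⋆ₐ[ℂ] MinTensor A B :=
  (allRepTensor A B).codRestrict (minTensorSubalgebra A B) fun x =>
    StarSubalgebra.le_topologicalClosure _ ⟨x, rfl⟩

variable {B} {C : Type v} [CStarAlgebra C]

/-- For `f : B → C`, the map on bounded families induced by composing representations of `C`
with `f`. -/
def reindexFamilies (f : B →⋆ₐ[ℂ] C) : BoundedFamilies A B →⋆ₐ[ℂ] BoundedFamilies A C where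
  toFun x := ⟨fun p => x (p.1, p.2.comap f), memℓp_infty (by
    refine ⟨‖x‖, ?_⟩
    rintro _ ⟨p, rfl⟩
    exact lp.norm_apply_le_norm ENNReal.top_ne_zero x (p.1, p.2.comap f))⟩
  map_one' := rfl
  map_mul' _ _ := rfl
  map_zero' := rfl
  map_add' _ _ := rfl
  commutes' _ := rfl
  map_star' _ := rfl

theorem reindexFamilies_allRepTensor (f : B →⋆ₐ[ℂ] C) (x : A ⊗[ℂ] B) :
    reindexFamilies A f (allRepTensor A B x) =
      allRepTensor A C (TensorProduct.map LinearMap.id f.toLinearMap x) := by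
  induction x using TensorProduct.induction_on with
  | zero => simp
  | add x y hx hy => simp only [map_add, hx, hy]
  | tmul a b => rfl

theorem continuous_reindexFamilies (f : B →⋆ₐ[ℂ] C) : Continuous (reindexFamilies A f) :=
  AddMonoidHomClass.continuous_of_bound (reindexFamilies A f) 1 fun x => by
    rw [one_mul]; exact NonUnitalStarAlgHom.norm_apply_le (reindexFamilies A f) x

theorem reindexFamilies_incl_mem (f : B →⋆ₐ[ℂ] C) (x : MinTensor A B) :
    reindexFamilies A f (MinTensor.incl A B x) ∈ minTensorSubalgebra A C := by
  have h : Set.MapsTo (reindexFamilies A f) (allRepTensor A B).range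
      (allRepTensor A C).range := by
    rintro _ ⟨y, rfl⟩
    exact ⟨TensorProduct.map LinearMap.id f.toLinearMap y,
      (reindexFamilies_allRepTensor A f y).symm⟩
  exact map_mem_closure (continuous_reindexFamilies A f) x.2 h

/-- The unital *-homomorphism `id ⊗ f` between minimal tensor products. -/
def MinTensor.idTensor (f : B →⋆ₐ[ℂ] C) : MinTensor A B →⋆ₐ[ℂ] MinTensor A C :=
  ((reindexFamilies A f).comp (MinTensor.incl A B)).codRestrict (minTensorSubalgebra A C)
    (reindexFamilies_incl_mem A f)

theorem MinTensor.idTensor_of_tmul (f : B →⋆ₐ[ℂ] C) (a : A) (b : B) :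
    MinTensor.idTensor A f (MinTensor.of A B (a ⊗ₜ[ℂ] b)) = MinTensor.of A C (a ⊗ₜ[ℂ] f b) := rfl

theorem MinTensor.norm_of (x : A ⊗[ℂ] B) :
    ‖MinTensor.of A B x‖ = ⨆ p : HilbertRep A × HilbertRep B, ‖repTensor p.1 p.2 x‖ :=
  lp.norm_eq_ciSup (allRepTensor A B x)

theorem MinTensor.denseRange_of : DenseRange (MinTensor.of A B) := by
  refine (Topology.IsInducing.subtypeVal (t := (minTensorSubalgebra A B : Set (BoundedFamilies A B)))).dense_iff.2
    fun x => closure_mono ?_ x.2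
  rintro _ ⟨y, rfl⟩
  exact ⟨MinTensor.of A B y, ⟨y, rfl⟩, rfl⟩

end MinTensor

/-- A unital C*-algebra is finitely generated if the unital *-subalgebra generated by some finite
subset is dense. -/
def IsFinitelyGeneratedCStar (B : Type v) [CStarAlgebra B] : Prop :=
  ∃ S : Finset B, (StarAlgebra.adjoin ℂ (S : Set B)).topologicalClosure = ⊤

/-- With `A = C(𝕏)`, `B = C(𝕐)`, `E = C(𝔼)`: a quantum family of maps `𝕏 → 𝕐` parametrized by the
compact quantum space `𝔼`, i.e. a unital *-homomorphism `C(𝕐) → C(𝕏) ⊗ C(𝔼)`. -/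
abbrev QuantumFamily (A : Type u) [CStarAlgebra A] (B : Type v) [CStarAlgebra B]
    (E : Type w) [CStarAlgebra E] : Type (max v (u + 1) (w + 1)) :=
  B →⋆ₐ[ℂ] MinTensor A E

/-- `Φ` is the quantum family of all maps (and its parameter space is the quantum space of all
maps) if each quantum family `Ψ` is `(id ⊗ Λ) ∘ Φ` for a unique unital *-homomorphism `Λ`. -/
def QuantumFamily.IsFamilyOfAllMaps {A : Type u} [CStarAlgebra A] {B : Type v} [CStarAlgebra B]
    {E : Type w} [CStarAlgebra E] (Φ : QuantumFamily A B E) : Prop :=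
  ∀ (D : Type w) [CStarAlgebra D] (Ψ : QuantumFamily A B D),
    ∃! Λ : E →⋆ₐ[ℂ] D, (MinTensor.idTensor A Λ).comp Φ = Ψ

end

/-!
Write `A` for the finite-dimensional algebra and fix a basis `b i` of it, with coordinate
functionals `φ i`. The slice maps `φ i ⊗ id : A ⊗ D → D` are bounded by `‖φ i‖`, uniformly in `D`
(`MinTensor.norm_slice_le`); this rests on the fact that representations attain the norm of a
C*-algebra (`HilbertRep.exists_norm_hom_eq`), which follows from Hahn–Banach and the GNS
construction. Hence every `z : A ⊗ D` is `∑ i, b i ⊗ (φ i ⊗ id) z` (`MinTensor.eq_sum_slice`), and a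
quantum family `Ψ : B → A ⊗ D` is the same thing as its family of coefficients
`(φ i ⊗ id) (Ψ β)` in `D`, whose norms are at most `‖φ i‖ * ‖β‖`.

The parameter algebra of the universal family is generated, inside the product of the parameter
algebras of "all" quantum families, by the bounded families of coefficients. Only the C*-seminorm
that a quantum family induces on *-polynomials in its coefficients matters, and the real-valued
functions on *-polynomials form a set, so that the product can be taken over a set of
representatives (`QuantumFamily.exists_small_representatives`). Finite generation of `B` bounds its
cardinality (`IsFinitelyGeneratedCStar.small`), so that this set has a copy in the universe of the
parameter algebras.

The elements `∑ i, b i ⊗ (coefficients of β)` define a *-homomorphism on `B`, since they do so after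
each projection to a factor and these projections jointly separate the points of the tensor product
(`JoinAlgebra.tensor_ext`). For any `Ψ`, *-polynomials in the universal coefficients dominate in
norm the same *-polynomials in the coefficients of `Ψ`, so the assignment of coefficients to
coefficients extends to a *-homomorphism (`exists_cstarSpan_hom`), and it is unique because the
coefficients generate.
-/

noncomputable section

/-! ### States and faithful representations -/

section States

open scoped ComplexOrder

variable {A : Type*} [CStarAlgebra A]

/-- Compare `|g (x + i t)|` with `‖x + i t‖` for large real `t` of either sign. -/
theorem im_apply_eq_zero_of_isSelfAdjoint {g : StrongDual ℂ A} (hg : ‖g‖ ≤ 1) (h1 : g 1 = 1)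
    {x : A} (hx : IsSelfAdjoint x) : (g x).im = 0 := by
  have key (t : ℝ) : ((g x).im + t) ^ 2 ≤ ‖x‖ ^ 2 + t ^ 2 := by
    set y : A := x + (t * Complex.I : ℂ) • (1 : A) with hy
    have hgy : (g y).im = (g x).im + t := by simp [hy, h1]
    have hyy : star y * y = x * x + ((t ^ 2 : ℝ) : ℂ) • (1 : A) := by
      have hI : (t * Complex.I : ℂ) * (t * Complex.I) = -((t ^ 2 : ℝ) : ℂ) := by
        push_cast; linear_combination (t : ℂ) ^ 2 * Complex.I_sq
      simp [hy, hx.star_eq, add_mul, mul_add, smul_smul, hI]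
    have hnorm : ‖y‖ ^ 2 ≤ ‖x‖ ^ 2 + t ^ 2 := by
      rw [sq ‖y‖, ← CStarRing.norm_star_mul_self, hyy]
      refine (norm_add_le _ _).trans (add_le_add ((norm_mul_le _ _).trans_eq (sq _).symm) ?_)
      rcases subsingleton_or_nontrivial A with _ | _
      · simpa [Subsingleton.elim (1 : A) 0] using sq_nonneg t
      · simp [norm_smul]
    have hle : |(g y).im| ≤ ‖y‖ :=
      (Complex.abs_im_le_norm _).trans ((g.le_opNorm y).trans
        (mul_le_of_le_one_left (norm_nonneg _) hg))
    rw [← hgy, ← sq_abs]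
    exact (pow_le_pow_left₀ (abs_nonneg _) hle 2).trans hnorm
  by_contra hne
  -- For this `t` the cross term `2 * (g x).im * t` alone exceeds `‖x‖ ^ 2`.
  have := key ((‖x‖ ^ 2 + 1) / (2 * (g x).im))
  have h2 : 2 * (g x).im * ((‖x‖ ^ 2 + 1) / (2 * (g x).im)) = ‖x‖ ^ 2 + 1 := by field_simp
  nlinarith [sq_nonneg (g x).im]

variable [PartialOrder A] [StarOrderedRing A]

/-- A unital functional of norm at most one is positive, because `‖‖x‖ - x‖ ≤ ‖x‖` for `x ≥ 0`. -/
theorem apply_nonneg_of_norm_le_one {g : StrongDual ℂ A} (hg : ‖g‖ ≤ 1) (h1 : g 1 = 1)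
    {x : A} (hx : 0 ≤ x) : 0 ≤ g x := by
  have him := im_apply_eq_zero_of_isSelfAdjoint hg h1 (IsSelfAdjoint.of_nonneg hx)
  refine Complex.nonneg_iff.2 ⟨?_, him.symm⟩
  set y : A := algebraMap ℝ A ‖x‖ - x with hy
  have hy0 : 0 ≤ y := sub_nonneg.2 (IsSelfAdjoint.le_algebraMap_norm_self (.of_nonneg hx))
  have hyn : ‖y‖ ≤ ‖x‖ := by
    rw [CStarAlgebra.norm_le_iff_le_algebraMap y (norm_nonneg x) hy0]
    exact sub_le_self _ hx
  have hgy : (g y).re = ‖x‖ - (g x).re := by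
    have : g (algebraMap ℝ A ‖x‖) = (‖x‖ : ℂ) := by
      rw [Algebra.algebraMap_eq_smul_one, ← Complex.coe_smul, map_smul, h1]; simp
    rw [hy, map_sub, this]; simp
  have : (g y).re ≤ ‖y‖ :=
    (Complex.re_le_norm _).trans ((g.le_opNorm y).trans
        (mul_le_of_le_one_left (norm_nonneg _) hg))
  linarith

/-- A Hahn–Banach functional norming `1 + h` takes at `1` and at `h` the largest values its norm
permits, so it is a state. -/
theorem exists_state_apply_eq_norm [Nontrivial A] {h : A} (hh : 0 ≤ h) :
    ∃ f : A →ₚ[ℂ] ℂ, f 1 = 1 ∧ f h = ‖h‖ := by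
  have h0 : 0 ≤ 1 + h := add_nonneg zero_le_one hh
  have hnorm : 1 + ‖h‖ ≤ ‖1 + h‖ := by
    have hle := (CStarAlgebra.norm_le_iff_le_algebraMap (1 + h) (norm_nonneg _) h0).1 le_rfl
    have h1 : 1 ≤ ‖1 + h‖ := by
      have := CStarAlgebra.norm_le_norm_of_nonneg_of_le (zero_le_one (α := A))
        (le_add_of_nonneg_right hh)
      simpa using this
    have : ‖h‖ ≤ ‖1 + h‖ - 1 := by
      rw [CStarAlgebra.norm_le_iff_le_algebraMap h (by linarith) hh, map_sub, map_one]
      exact le_sub_iff_add_le'.2 hle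
    linarith
  obtain ⟨g, hg, hgh⟩ := exists_dual_vector'' ℂ (1 + h)
  have e1 : ‖g 1‖ ≤ 1 := by simpa using g.le_of_opNorm_le hg 1
  have e2 : ‖g h‖ ≤ ‖h‖ := by simpa using g.le_of_opNorm_le hg h
  have hsum : (g 1).re + (g h).re = ‖1 + h‖ := by
    have := congrArg Complex.re hgh
    simpa using this
  have r1 := Complex.re_le_norm (g 1)
  have r2 := Complex.re_le_norm (g h)
  have eq_of {z : ℂ} {r : ℝ} (hz : z.re = r) (hzn : ‖z‖ ≤ r) : z = r := by
    have := Complex.sq_norm_sub_sq_re z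
    refine Complex.ext (by simpa using hz) ?_
    have h3 : z.im ^ 2 ≤ 0 := by nlinarith [norm_nonneg z]
    simpa using pow_eq_zero_iff (two_ne_zero) |>.1 (le_antisymm h3 (sq_nonneg _))
  have g1 : g 1 = 1 := by simpa using eq_of (r := 1) (by linarith) e1
  have gh : g h = ‖h‖ := eq_of (by linarith) e2
  refine ⟨.mk g.toLinearMap fun x y hxy => ?_, g1, gh⟩
  have := apply_nonneg_of_norm_le_one hg g1 (sub_nonneg.2 hxy)
  rwa [map_sub, sub_nonneg] at this

end States

open scoped ComplexOrder in
/-- Every nonzero element attains its norm in some representation, by the GNS construction for a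
state that norms `star a * a`. -/
theorem HilbertRep.exists_norm_hom_eq {A : Type u} [CStarAlgebra A] {a : A} (ha : a ≠ 0) :
    ∃ π : HilbertRep A, ‖π.hom a‖ = ‖a‖ := by
  let := CStarAlgebra.spectralOrder A
  have := CStarAlgebra.spectralOrderedRing A
  have : Nontrivial A := ⟨a, 0, ha⟩
  obtain ⟨f, hf1, hfa⟩ := exists_state_apply_eq_norm (star_mul_self_nonneg a)
  let ξ : f.GNS := (f.toPreGNS 1 : f.PreGNS)
  have hξ : ‖ξ‖ = 1 := by
    rw [UniformSpace.Completion.norm_coe, PositiveLinearMap.preGNS_norm_def]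
    simp [hf1]
  have hπ : ‖f.gnsStarAlgHom a ξ‖ = ‖a‖ := by
    have : f.gnsStarAlgHom a ξ = (f.leftMulMapPreGNS a (f.toPreGNS 1) : f.PreGNS) :=
      PositiveLinearMap.gnsNonUnitalStarAlgHom_apply_coe f
    rw [this, UniformSpace.Completion.norm_coe, PositiveLinearMap.preGNS_norm_def]
    simp [hfa, CStarRing.norm_star_mul_self]
  have : Nontrivial f.GNS := ⟨ξ, 0, fun h => by simp [h] at hξ⟩
  refine ⟨⟨f.GNS, f.gnsStarAlgHom⟩, le_antisymm (NonUnitalStarAlgHom.norm_apply_le _ a) ?_⟩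
  have := (f.gnsStarAlgHom a).le_opNorm ξ
  rwa [hπ, hξ, mul_one] at this

/-! ### Slice maps on the minimal tensor product -/

section Slices

theorem opNorm_le_of_norm_inner_le {K : Type*} [NormedAddCommGroup K] [InnerProductSpace ℂ K]
    (T : K →L[ℂ] K) {C : ℝ} (hC : 0 ≤ C)
    (h : ∀ ξ η, ‖inner ℂ ξ (T η)‖ ≤ C * ‖ξ‖ * ‖η‖) : ‖T‖ ≤ C := by
  refine T.opNorm_le_bound hC fun η => ?_
  rcases (norm_nonneg (T η)).eq_or_lt with h0 | h0
  · rw [← h0]; positivity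
  · have := h (T η) η
    rw [inner_self_eq_norm_sq_to_K, norm_pow, RCLike.norm_ofReal, abs_norm, sq] at this
    exact le_of_mul_le_mul_left (this.trans_eq (by ring)) h0

theorem continuous_starAlgHom {X Y : Type*} [CStarAlgebra X] [CStarAlgebra Y] (f : X →⋆ₐ[ℂ] Y) :
    Continuous f :=
  AddMonoidHomClass.continuous_of_bound f 1 fun x => by
    rw [one_mul]; exact NonUnitalStarAlgHom.norm_apply_le f x

variable {A : Type u} [CStarAlgebra A] {D : Type v} [CStarAlgebra D]

theorem MinTensor.norm_repTensor_le (x : A ⊗[ℂ] D) (π : HilbertRep A) (ρ : HilbertRep D) :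
    ‖repTensor π ρ x‖ ≤ ‖MinTensor.of A D x‖ :=
  lp.norm_apply_le_norm ENNReal.top_ne_zero (allRepTensor A D x) (π, ρ)

/-- The slice map `φ ⊗ id` on the algebraic tensor product, `a ⊗ d ↦ φ(a) d`. -/
def algSlice (φ : StrongDual ℂ A) : A ⊗[ℂ] D →ₗ[ℂ] D :=
  (TensorProduct.lid ℂ D).toLinearMap ∘ₗ TensorProduct.map φ.toLinearMap LinearMap.id

theorem algSlice_tmul (φ : StrongDual ℂ A) (a : A) (d : D) :
    algSlice φ (a ⊗ₜ[ℂ] d) = φ a • d := rfl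

/-- The slice map `a ⊗ d ↦ ⟨ξ, ρ(d) η⟩ a` given by a vector functional of a representation. -/
def vectorSlice (ρ : HilbertRep D) (ξ η : ρ.space) : A ⊗[ℂ] D →ₗ[ℂ] A :=
  (TensorProduct.rid ℂ A).toLinearMap ∘ₗ TensorProduct.map LinearMap.id
    ((innerSL ℂ ξ).toLinearMap ∘ₗ (ContinuousLinearMap.apply ℂ ρ.space η).toLinearMap ∘ₗ
      ρ.hom.toLinearMap)

theorem vectorSlice_tmul (ρ : HilbertRep D) (ξ η : ρ.space) (a : A) (d : D) :
    vectorSlice ρ ξ η (a ⊗ₜ[ℂ] d) = (inner ℂ ξ (ρ.hom d η) : ℂ) • a := rfl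

/-- Slices in the second leg by vector functionals of a representation of `D` are contractive up
to the norms of the vectors: a matrix coefficient of the slice in a representation of `A` is a
matrix coefficient of `x` between elementary tensors. -/
theorem norm_vectorSlice_le (x : A ⊗[ℂ] D) (ρ : HilbertRep D) (ξ η : ρ.space) :
    ‖vectorSlice ρ ξ η x‖ ≤ ‖MinTensor.of A D x‖ * ‖ξ‖ * ‖η‖ := by
  by_cases h0 : vectorSlice ρ ξ η x = 0
  · rw [h0, norm_zero]; positivity
  obtain ⟨π, hπ⟩ := HilbertRep.exists_norm_hom_eq h0
  rw [← hπ]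
  refine opNorm_le_of_norm_inner_le _ (by positivity) fun h' h => ?_
  have key : inner ℂ h' (π.hom (vectorSlice ρ ξ η x) h) =
      inner ℂ (HilbertTensor.of _ _ (h' ⊗ₜ[ℂ] ξ))
        (repTensor π ρ x (HilbertTensor.of _ _ (h ⊗ₜ[ℂ] η))) := by
    clear h0 hπ
    induction x using TensorProduct.induction_on with
    | zero => simp
    | add x y hx hy =>
      simp only [map_add, add_apply, inner_add_right, hx, hy]
    | tmul a d =>
      rw [repTensor_tmul, opTensor_tmul, LinearIsometry.inner_map_map, TensorProduct.inner_tmul]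
      simp [vectorSlice_tmul, mul_comm]
  rw [key]
  refine (norm_inner_le_norm _ _).trans ?_
  have h1 := (repTensor π ρ x).le_opNorm (HilbertTensor.of _ _ (h ⊗ₜ[ℂ] η))
  rw [LinearIsometry.norm_map, TensorProduct.norm_tmul] at h1 ⊢
  calc _ ≤ ‖h'‖ * ‖ξ‖ * (‖MinTensor.of A D x‖ * (‖h‖ * ‖η‖)) := by
        gcongr
        refine h1.trans ?_
        gcongr
        exact MinTensor.norm_repTensor_le x π ρ
    _ = _ := by ring

theorem norm_algSlice_le (φ : StrongDual ℂ A) (x : A ⊗[ℂ] D) :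
    ‖algSlice φ x‖ ≤ ‖φ‖ * ‖MinTensor.of A D x‖ := by
  by_cases h0 : algSlice φ x = 0
  · rw [h0, norm_zero]; positivity
  obtain ⟨ρ, hρ⟩ := HilbertRep.exists_norm_hom_eq h0
  rw [← hρ]
  refine opNorm_le_of_norm_inner_le _ (by positivity) fun ξ η => ?_
  have key : inner ℂ ξ (ρ.hom (algSlice φ x) η) =
      φ (vectorSlice ρ ξ η x) := by
    clear h0 hρ
    induction x using TensorProduct.induction_on with
    | zero => simp
    | add x y hx hy =>
      simp only [map_add, add_apply, inner_add_right, hx, hy]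
    | tmul a d =>
      simp [algSlice_tmul, vectorSlice_tmul, mul_comm]
  rw [key]
  refine (φ.le_opNorm _).trans ?_
  rw [mul_assoc, mul_assoc, ← mul_assoc (‖MinTensor.of A D x‖)]
  exact mul_le_mul_of_nonneg_left (norm_vectorSlice_le x ρ ξ η) (norm_nonneg _)

/-- The slice map `φ ⊗ id` on the minimal tensor product. -/
def MinTensor.slice (φ : StrongDual ℂ A) : MinTensor A D →L[ℂ] D :=
  (algSlice φ).extendOfNorm (MinTensor.of A D).toLinearMap

theorem MinTensor.slice_of (φ : StrongDual ℂ A) (x : A ⊗[ℂ] D) :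
    MinTensor.slice φ (MinTensor.of A D x) = algSlice φ x :=
  LinearMap.extendOfNorm_eq (MinTensor.denseRange_of A) ⟨‖φ‖, norm_algSlice_le φ⟩ x

theorem MinTensor.norm_slice_le (φ : StrongDual ℂ A) (z : MinTensor A D) :
    ‖MinTensor.slice φ z‖ ≤ ‖φ‖ * ‖z‖ :=
  LinearMap.norm_extendOfNorm_apply_le (MinTensor.denseRange_of A) _ (norm_algSlice_le φ) z

theorem MinTensor.slice_idTensor {E : Type v} [CStarAlgebra E] (φ : StrongDual ℂ A)
    (f : D →⋆ₐ[ℂ] E) (z : MinTensor A D) :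
    MinTensor.slice φ (MinTensor.idTensor A f z) = f (MinTensor.slice φ z) := by
  refine (MinTensor.denseRange_of A).induction_on z
    (isClosed_eq ((ContinuousLinearMap.continuous _).comp (continuous_starAlgHom _))
      ((continuous_starAlgHom f).comp (ContinuousLinearMap.continuous _))) fun x => ?_
  induction x using TensorProduct.induction_on with
  | zero => simp
  | add x y hx hy => simp only [map_add, hx, hy]
  | tmul a d =>
    rw [MinTensor.idTensor_of_tmul, slice_of, slice_of, algSlice_tmul, algSlice_tmul, map_smul]

variable {ι : Type*} [FiniteDimensional ℂ A] (b : Module.Basis ι ℂ A)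

/-- The coordinate functionals of a basis of a finite-dimensional C*-algebra. -/
def coordDual (i : ι) : StrongDual ℂ A := LinearMap.toContinuousLinearMap (b.coord i)

theorem coordDual_apply (i : ι) (a : A) : coordDual b i a = b.repr a i := rfl

variable [Fintype ι]

/-- Elements of the completed tensor product with a finite-dimensional C*-algebra are finite sums of
elementary tensors: the identity is clear on the algebraic tensor product, and both sides are
continuous. -/
theorem MinTensor.eq_sum_slice (z : MinTensor A D) :
    z = ∑ i, MinTensor.of A D (b i ⊗ₜ[ℂ] MinTensor.slice (coordDual b i) z) := by
  have hc (i : ι) : Continuous fun d : D => MinTensor.of A D (b i ⊗ₜ[ℂ] d) := by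
    let T : D →ₗ[ℂ] MinTensor A D :=
      (MinTensor.of A D).toLinearMap ∘ₗ TensorProduct.mk ℂ A D (b i)
    refine AddMonoidHomClass.continuous_of_bound T ‖b i‖ fun d => ?_
    change ‖MinTensor.of A D (b i ⊗ₜ[ℂ] d)‖ ≤ _
    refine lp.norm_le_of_forall_le (by positivity) fun p => ?_
    refine (norm_opTensor_le _ _).trans ?_
    gcongr <;> exact NonUnitalStarAlgHom.norm_apply_le _ _
  refine (MinTensor.denseRange_of A).induction_on z
    (isClosed_eq continuous_id (continuous_finsetSum _ fun i _ =>
      (hc i).comp (ContinuousLinearMap.continuous _))) fun x => ?_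
  induction x using TensorProduct.induction_on with
  | zero => simp
  | add x y hx hy =>
    simp only [map_add, TensorProduct.tmul_add, Finset.sum_add_distrib]
    rw [← hx, ← hy]
  | tmul a d =>
    simp only [slice_of, algSlice_tmul, coordDual_apply, ← TensorProduct.smul_tmul]
    rw [← map_sum, ← TensorProduct.sum_tmul, b.sum_repr]

theorem MinTensor.ext_slice {z z' : MinTensor A D}
    (h : ∀ i, MinTensor.slice (coordDual b i) z = MinTensor.slice (coordDual b i) z') : z = z' := by
  rw [MinTensor.eq_sum_slice b z, MinTensor.eq_sum_slice b z']
  simp only [h]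

theorem MinTensor.slice_sum_of [DecidableEq ι] (d : ι → D) (i : ι) :
    MinTensor.slice (coordDual b i) (∑ j, MinTensor.of A D (b j ⊗ₜ[ℂ] d j)) = d i := by
  simp [slice_of, algSlice_tmul, coordDual_apply, Finsupp.single_apply]

end Slices

/-! ### C*-algebras generated by a family of elements -/

section Generators

open Filter Topology

/-- The evaluation of *-polynomials at a family `x`. A *-polynomial is encoded as an element of the
free algebra on `J ⊕ J`, whose second copy of `J` stands for the adjoints of the variables. -/
def starLift {J : Type*} {D : Type*} [CStarAlgebra D] (x : J → D) :
    FreeAlgebra ℂ (J ⊕ J) →ₐ[ℂ] D :=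
  FreeAlgebra.lift ℂ (Sum.elim x fun j => star (x j))

variable {J : Type*} {D : Type*} [CStarAlgebra D] {E : Type*} [CStarAlgebra E]

theorem starLift_inl (x : J → D) (j : J) : starLift x (FreeAlgebra.ι ℂ (Sum.inl j)) = x j := by
  simp [starLift]

theorem range_starLift (x : J → D) :
    (starLift x).range = (StarAlgebra.adjoin ℂ (Set.range x)).toSubalgebra := by
  rw [StarAlgebra.adjoin_toSubalgebra, starLift, ← Algebra.adjoin_range_eq_range_freeAlgebra_lift,
    Set.Sum.elim_range]
  congr 2
  ext y
  simp only [Set.mem_range, Set.mem_star]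
  exact exists_congr fun j => ⟨fun h => by rw [← h, star_star], fun h => by rw [h, star_star]⟩

theorem map_starLift (f : D →⋆ₐ[ℂ] E) (x : J → D) (p : FreeAlgebra ℂ (J ⊕ J)) :
    f (starLift x p) = starLift (fun j => f (x j)) p := by
  have : f.toAlgHom.comp (starLift x) = starLift (fun j => f (x j)) :=
    FreeAlgebra.hom_ext <| funext fun j => by
      cases j with
      | inl j => simp [starLift]
      | inr j => simpa [starLift] using map_star f (x j)
  exact DFunLike.congr_fun this p

/-- The adjoint of a *-polynomial in a family is a *-polynomial that does not depend on the
family. -/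
theorem exists_starLift_eq_star (x : J → D) (y : J → E) (p : FreeAlgebra ℂ (J ⊕ J)) :
    ∃ p', starLift x p' = star (starLift x p) ∧ starLift y p' = star (starLift y p) := by
  induction p using FreeAlgebra.induction with
  | grade0 r =>
    exact ⟨algebraMap _ _ (star r), by simp only [AlgHom.commutes, algebraMap_star_comm],
      by simp only [AlgHom.commutes, algebraMap_star_comm]⟩
  | grade1 j =>
    cases j with
    | inl j => exact ⟨.ι ℂ (.inr j), by simp [starLift], by simp [starLift]⟩
    | inr j => exact ⟨.ι ℂ (.inl j), by simp [starLift], by simp [starLift]⟩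
  | mul p q hp hq =>
    obtain ⟨p', h1, h2⟩ := hp
    obtain ⟨q', h3, h4⟩ := hq
    exact ⟨q' * p', by simp [h1, h3], by simp [h2, h4]⟩
  | add p q hp hq =>
    obtain ⟨p', h1, h2⟩ := hp
    obtain ⟨q', h3, h4⟩ := hq
    exact ⟨p' + q', by simp [h1, h3], by simp [h2, h4]⟩

/-- The C*-subalgebra generated by a family of elements. -/
def cstarSpan (x : J → D) : StarSubalgebra ℂ D :=
  (StarAlgebra.adjoin ℂ (Set.range x)).topologicalClosure

instance (x : J → D) : CStarAlgebra (cstarSpan x) :=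
  StarSubalgebra.cstarAlgebra (cstarSpan x)
    (h_closed := StarSubalgebra.isClosed_topologicalClosure _)

theorem starLift_mem_cstarSpan (x : J → D) (p : FreeAlgebra ℂ (J ⊕ J)) :
    starLift x p ∈ cstarSpan x := by
  refine StarSubalgebra.le_topologicalClosure _ ?_
  have : starLift x p ∈ (starLift x).range := ⟨p, rfl⟩
  rwa [range_starLift] at this

theorem mem_cstarSpan (x : J → D) (j : J) : x j ∈ cstarSpan x := by
  rw [← starLift_inl x j]; exact starLift_mem_cstarSpan x _

/-- `starLift` with values in the generated C*-subalgebra. -/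
def starLiftSpan (x : J → D) : FreeAlgebra ℂ (J ⊕ J) →ₐ[ℂ] cstarSpan x :=
  (starLift x).codRestrict (cstarSpan x).toSubalgebra (starLift_mem_cstarSpan x)

theorem denseRange_starLiftSpan (x : J → D) : DenseRange (starLiftSpan x) := by
  refine (Topology.IsInducing.subtypeVal (t := (cstarSpan x : Set D))).dense_iff.2
    fun z => closure_mono ?_ z.2
  intro y hy
  have hy' : y ∈ (starLift x).range := by rw [range_starLift]; exact hy
  obtain ⟨p, rfl⟩ := hy'
  exact ⟨starLiftSpan x p, ⟨p, rfl⟩, rfl⟩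

theorem starLiftSpan_inl (x : J → D) (j : J) :
    starLiftSpan x (FreeAlgebra.ι ℂ (Sum.inl j)) = ⟨x j, mem_cstarSpan x j⟩ :=
  Subtype.ext (starLift_inl x j)

theorem cstarSpan_hom_ext (x : J → D) {f g : cstarSpan x →⋆ₐ[ℂ] E}
    (h : ∀ j, f ⟨x j, mem_cstarSpan x j⟩ = g ⟨x j, mem_cstarSpan x j⟩) : f = g := by
  have hs (p) : starLiftSpan x p =
      starLift (fun j => (⟨x j, mem_cstarSpan x j⟩ : cstarSpan x)) p :=
    Subtype.ext (map_starLift (cstarSpan x).subtype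
      (fun j => (⟨x j, mem_cstarSpan x j⟩ : cstarSpan x)) p).symm
  refine DFunLike.coe_injective ((denseRange_starLiftSpan x).equalizer
    (continuous_starAlgHom f) (continuous_starAlgHom g) (funext fun p => ?_))
  simp only [Function.comp_apply, hs, map_starLift, h]

/-- If every *-polynomial is at least as large at `x` as at `y`, then `x j ↦ y j` extends to the
C*-algebra generated by `x`. -/
theorem exists_cstarSpan_hom (x : J → D) (y : J → E)
    (h : ∀ p, ‖starLift y p‖ ≤ ‖starLift x p‖) :
    ∃ f : cstarSpan x →⋆ₐ[ℂ] E, ∀ j, f ⟨x j, mem_cstarSpan x j⟩ = y j := by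
  have hd := denseRange_starLiftSpan x
  let f : cstarSpan x →L[ℂ] E :=
    (starLift y).toLinearMap.extendOfNorm (starLiftSpan x).toLinearMap
  have hf (p) : f (starLiftSpan x p) = starLift y p :=
    LinearMap.extendOfNorm_eq (f := (starLift y).toLinearMap)
      (e := (starLiftSpan x).toLinearMap) hd ⟨1, fun p => by rw [one_mul]; exact h p⟩ p
  have hone : f 1 = 1 := by rw [← map_one (starLiftSpan x), hf, map_one]
  have hmul (z z') : f (z * z') = f z * f z' := by
    refine hd.induction_on₂ (p := fun z z' => f (z * z') = f z * f z')
      (isClosed_eq (by fun_prop) (by fun_prop)) (fun p q => ?_) z z'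
    rw [← map_mul, hf, hf, hf, map_mul]
  have hstar (z) : f (star z) = star (f z) := by
    refine hd.induction_on (p := fun z => f (star z) = star (f z)) z
      (isClosed_eq (by fun_prop) (by fun_prop)) fun p => ?_
    obtain ⟨p', h1, h2⟩ := exists_starLift_eq_star x y p
    have : star (starLiftSpan x p) = starLiftSpan x p' := Subtype.ext h1.symm
    rw [this, hf, hf, h2]
  refine ⟨{ AlgHom.ofLinearMap f.toLinearMap hone hmul with map_star' := hstar }, fun j => ?_⟩
  change f _ = _
  rw [← starLiftSpan_inl, hf, starLift_inl]

/-- A finitely generated C*-algebra has at most the cardinality of the continuum, since its elements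
are limits of sequences of *-polynomials in finitely many variables; hence it has a copy in every
universe. -/
theorem IsFinitelyGeneratedCStar.small {B : Type v} [CStarAlgebra B]
    (hB : IsFinitelyGeneratedCStar B) : Small.{w} B := by
  obtain ⟨S, hS⟩ := hB
  let x : Fin S.card → B := fun i => S.equivFin.symm i
  have hx : Set.range x = S := by
    ext b
    constructor
    · rintro ⟨i, rfl⟩; exact (S.equivFin.symm i).2
    · intro hb; exact ⟨S.equivFin ⟨b, hb⟩, by simp [x]⟩
  let F := FreeAlgebra ℂ (Fin S.card ⊕ Fin S.card)
  have : Small.{w} (ℕ → F) := small_zero _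
  -- `limUnder` has a junk value on the sequences without a limit, which does no harm.
  refine small_of_surjective (f := fun s : ℕ → F => limUnder atTop fun n => starLift x (s n))
    fun b => ?_
  have hb : b ∈ (StarAlgebra.adjoin ℂ (S : Set B)).topologicalClosure := by rw [hS]; trivial
  obtain ⟨s, hs, hlim⟩ := mem_closure_iff_seq_limit.1 hb
  have hs' (n) : ∃ p, starLift x p = s n := by
    have : s n ∈ (starLift x).range := by rw [range_starLift, hx]; exact hs n
    exact this
  choose p hp using hs'
  refine ⟨p, ?_⟩
  simp only [hp]
  exact hlim.limUnder_eq

end Generators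

/-! ### The join of all quantum families -/

section Universal

/-- The evaluation of bounded families at an index. -/
def lpEval {I : Type*} {D : I → Type*} [∀ k, Nontrivial (D k)] [∀ k, CStarAlgebra (D k)] (k : I) :
    lp D ∞ →⋆ₐ[ℂ] D k where
  toFun z := z k
  map_one' := rfl
  map_mul' _ _ := rfl
  map_zero' := rfl
  map_add' _ _ := rfl
  commutes' _ := rfl
  map_star' _ := rfl

variable {A : Type u} [CStarAlgebra A] [FiniteDimensional ℂ A] {B : Type v} [CStarAlgebra B]
  {ι : Type*} (b : Module.Basis ι ℂ A)

/-- The coefficients of a quantum family with respect to a basis of `A`, indexed by the basis and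
by a copy `B'` of `B`. -/
def QuantumFamily.coeff {B' : Type*} (e : B' → B) {D : Type*} [CStarAlgebra D]
    (Ψ : QuantumFamily A B D) (j : ι × B') : D :=
  MinTensor.slice (coordDual b j.1) (Ψ (e j.2))

theorem QuantumFamily.norm_coeff_le {B' : Type*} (e : B' → B) {D : Type*} [CStarAlgebra D]
    (Ψ : QuantumFamily A B D) (j : ι × B') :
    ‖Ψ.coeff b e j‖ ≤ ‖coordDual b j.1‖ * ‖e j.2‖ :=
  (MinTensor.norm_slice_le _ _).trans
    (mul_le_mul_of_nonneg_left (NonUnitalStarAlgHom.norm_apply_le Ψ _) (norm_nonneg _))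

/-- Up to the C*-seminorms that they induce on *-polynomials in the coefficients, the quantum
families with nonzero parameter algebra form a set in the universe of the indices. -/
theorem QuantumFamily.exists_small_representatives {ι : Type w} {B' : Type w}
    (b : Module.Basis ι ℂ A) (e : B' → B) :
    ∃ (I : Type w) (D : I → Type w) (_ : ∀ k, CStarAlgebra (D k)) (_ : ∀ k, Nontrivial (D k))
      (Ψ : ∀ k, QuantumFamily A B (D k)),
      ∀ (D' : Type w) [CStarAlgebra D'] [Nontrivial D'] (Ψ' : QuantumFamily A B D'),
        ∃ k, ∀ p, ‖starLift (Ψ'.coeff b e) p‖ = ‖starLift ((Ψ k).coeff b e) p‖ := by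
  let P (q : FreeAlgebra ℂ ((ι × B') ⊕ (ι × B')) → ℝ) : Prop :=
    ∃ (D : Type w) (_ : CStarAlgebra D) (_ : Nontrivial D) (Ψ : QuantumFamily A B D),
      ∀ p, q p = ‖starLift (Ψ.coeff b e) p‖
  have hP (k : Subtype P) : P k.1 := k.2
  choose D hD hD' Ψ hΨ using hP
  exact ⟨Subtype P, D, hD, hD', Ψ, fun D' _ _ Ψ' =>
    ⟨⟨fun p => ‖starLift (Ψ'.coeff b e) p‖, D', _, ‹_›, Ψ', fun _ => rfl⟩,
      fun p => hΨ ⟨fun p => ‖starLift (Ψ'.coeff b e) p‖, _⟩ p⟩⟩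

variable {I : Type w} {D : I → Type w} [∀ k, CStarAlgebra (D k)] [∀ k, Nontrivial (D k)]
  (Ψ : ∀ k, QuantumFamily A B (D k)) {B' : Type w} (e : B' ≃ B)

/-- The coefficients of a set of quantum families, as bounded families. -/
def coeffFamily (j : ι × B') : lp D ∞ :=
  ⟨fun k => (Ψ k).coeff b e j, memℓp_infty (by
    refine ⟨‖coordDual b j.1‖ * ‖e j.2‖, ?_⟩
    rintro _ ⟨k, rfl⟩
    exact (Ψ k).norm_coeff_le b e j)⟩

/-- The parameter algebra of the join of a set of quantum families: it is generated by the
coefficients inside the product of the parameter algebras. -/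
abbrev JoinAlgebra : Type w := cstarSpan (coeffFamily b Ψ e)

/-- The generators of `JoinAlgebra`. -/
def JoinAlgebra.gen (j : ι × B') : JoinAlgebra b Ψ e :=
  ⟨coeffFamily b Ψ e j, mem_cstarSpan _ j⟩

/-- The projection of `JoinAlgebra` to one of the parameter algebras. -/
def JoinAlgebra.proj (k : I) : JoinAlgebra b Ψ e →⋆ₐ[ℂ] D k :=
  (lpEval k).comp (cstarSpan (coeffFamily b Ψ e)).subtype

theorem JoinAlgebra.proj_gen (k : I) (j : ι × B') :
    JoinAlgebra.proj b Ψ e k (JoinAlgebra.gen b Ψ e j) = (Ψ k).coeff b e j := rfl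

theorem JoinAlgebra.ext_proj {z z' : JoinAlgebra b Ψ e}
    (h : ∀ k, JoinAlgebra.proj b Ψ e k z = JoinAlgebra.proj b Ψ e k z') : z = z' :=
  Subtype.ext (lp.ext (funext h))

variable [Fintype ι]

theorem JoinAlgebra.tensor_ext {z z' : MinTensor A (JoinAlgebra b Ψ e)}
    (h : ∀ k, MinTensor.idTensor A (JoinAlgebra.proj b Ψ e k) z =
      MinTensor.idTensor A (JoinAlgebra.proj b Ψ e k) z') : z = z' := by
  refine MinTensor.ext_slice b fun i => JoinAlgebra.ext_proj b Ψ e fun k => ?_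
  rw [← MinTensor.slice_idTensor, h k, MinTensor.slice_idTensor]

/-- The value at an element of `B` of the join of a set of quantum families. -/
def joinFun (β : B) : MinTensor A (JoinAlgebra b Ψ e) :=
  ∑ i, MinTensor.of A _ (b i ⊗ₜ[ℂ] JoinAlgebra.gen b Ψ e (i, e.symm β))

theorem slice_joinFun (β : B) (i : ι) :
    MinTensor.slice (coordDual b i) (joinFun b Ψ e β) = JoinAlgebra.gen b Ψ e (i, e.symm β) := by
  classical exact MinTensor.slice_sum_of b _ i

theorem idTensor_proj_joinFun (k : I) (β : B) :
    MinTensor.idTensor A (JoinAlgebra.proj b Ψ e k) (joinFun b Ψ e β) = Ψ k β := by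
  refine MinTensor.ext_slice b fun i => ?_
  rw [MinTensor.slice_idTensor, slice_joinFun, JoinAlgebra.proj_gen, QuantumFamily.coeff,
    Equiv.apply_symm_apply]

/-- The join of a set of quantum families. It is a *-homomorphism because its projections are. -/
def joinFamily : QuantumFamily A B (JoinAlgebra b Ψ e) where
  toFun := joinFun b Ψ e
  map_one' := JoinAlgebra.tensor_ext b Ψ e fun k => by simp only [idTensor_proj_joinFun, map_one]
  map_mul' _ _ := JoinAlgebra.tensor_ext b Ψ e fun k => by
    simp only [idTensor_proj_joinFun, map_mul]
  map_zero' := JoinAlgebra.tensor_ext b Ψ e fun k => by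
    simp only [idTensor_proj_joinFun, map_zero]
  map_add' _ _ := JoinAlgebra.tensor_ext b Ψ e fun k => by
    simp only [idTensor_proj_joinFun, map_add]
  commutes' c := JoinAlgebra.tensor_ext b Ψ e fun k => by
    simp only [idTensor_proj_joinFun, AlgHomClass.commutes]
  map_star' _ := JoinAlgebra.tensor_ext b Ψ e fun k => by
    simp only [idTensor_proj_joinFun, map_star]

/-- A given family factors through the join by `f` exactly when `f` maps the universal coefficients
to the coefficients of the family. -/
theorem idTensor_comp_joinFamily_eq_iff {D' : Type w} [CStarAlgebra D'] (Ψ' : QuantumFamily A B D')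
    (f : JoinAlgebra b Ψ e →⋆ₐ[ℂ] D') :
    (MinTensor.idTensor A f).comp (joinFamily b Ψ e) = Ψ' ↔
      ∀ j, f (JoinAlgebra.gen b Ψ e j) = Ψ'.coeff b e j := by
  have hslice (β : B) (i : ι) : MinTensor.slice (coordDual b i)
      ((MinTensor.idTensor A f).comp (joinFamily b Ψ e) β) =
        f (JoinAlgebra.gen b Ψ e (i, e.symm β)) := by
    rw [← slice_joinFun, ← MinTensor.slice_idTensor]; rfl
  constructor
  · rintro rfl ⟨i, β⟩
    rw [QuantumFamily.coeff, hslice, e.symm_apply_apply]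
  · intro h
    refine StarAlgHom.ext fun β => MinTensor.ext_slice b fun i => ?_
    rw [hslice, h, QuantumFamily.coeff, e.apply_symm_apply]

/-- If the C*-seminorm of every family is dominated by that of a member of the set, then the join
is the family of all maps. -/
theorem joinFamily_isFamilyOfAllMaps
    (hΨ : ∀ (D' : Type w) [CStarAlgebra D'] [Nontrivial D'] (Ψ' : QuantumFamily A B D'),
      ∃ k, ∀ p, ‖starLift (Ψ'.coeff b e) p‖ = ‖starLift ((Ψ k).coeff b e) p‖) :
    (joinFamily b Ψ e).IsFamilyOfAllMaps := by
  intro D' _ Ψ'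
  have hdom (p) : ‖starLift (Ψ'.coeff b e) p‖ ≤ ‖starLift (coeffFamily b Ψ e) p‖ := by
    -- The zero algebra is not among the representatives, but its seminorm vanishes.
    rcases subsingleton_or_nontrivial D' with _ | _
    · rw [Subsingleton.elim (starLift (Ψ'.coeff b e) p) 0, norm_zero]; exact norm_nonneg _
    · obtain ⟨k, hk⟩ := hΨ D' Ψ'
      have : lpEval k (starLift (coeffFamily b Ψ e) p) = starLift ((Ψ k).coeff b e) p :=
        map_starLift (lpEval k) (coeffFamily b Ψ e) p
      rw [hk, ← this]
      exact NonUnitalStarAlgHom.norm_apply_le (lpEval k) _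
  obtain ⟨f, hf⟩ := exists_cstarSpan_hom _ _ hdom
  refine ⟨f, (idTensor_comp_joinFamily_eq_iff b Ψ e Ψ' f).2 hf, fun g hg => ?_⟩
  have hg' := (idTensor_comp_joinFamily_eq_iff b Ψ e Ψ' g).1 hg
  exact cstarSpan_hom_ext _ fun j => (hg' j).trans (hf j).symm

end Universal

end

theorem theorem4p2 (A : Type u) [CStarAlgebra A] [FiniteDimensional ℂ A]
    (B : Type v) [CStarAlgebra B] (hB : IsFinitelyGeneratedCStar B) :
    ∃ (E : Type w) (_ : CStarAlgebra E) (Φ : QuantumFamily A B E), Φ.IsFamilyOfAllMaps := by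
  have : Small.{w} B := hB.small
  let b := (Module.finBasis ℂ A).reindex (Equiv.ulift.{w}).symm
  let e := (equivShrink.{w} B).symm
  obtain ⟨I, D, _, _, Ψ, hΨ⟩ := QuantumFamily.exists_small_representatives b e
  exact ⟨JoinAlgebra b Ψ e, inferInstance, joinFamily b Ψ e, joinFamily_isFamilyOfAllMaps b Ψ e hΨ⟩
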